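/- **Theorem (Reconstruction of distance-hereditary graphs).** A finite simple graph $G$ is *distance-hereditary* if for every connected induced subgraph $H$ of $G$ and all nodes $u,v$ of $H$ one has $d_H(u,v)=d_G(u,v)$. In the *number-in-hand (NIH) network model* the input is a simple undirected graph $G$ on the node set $[k]$; each player $v\in[k]$ holds only the characteristic vector $\nu_v\in\{0,1\}^k$ of its neighborhood in $G$. In a *quantum simultaneous-message-passing protocol* each player sends one quantum message, a state of some number of qubits that depends only on the player and on its own input (there is no shared randomness and no shared entanglement), to a referee who has no input, and the referee produces an output by measuring the messages jointly. The *communication cost* is the total number of qubits sent. There is a constant $C$ such that for every $k$ there is a quantum simultaneous-message-passing protocol for $k$ players in the NIH network model, with communication cost at most $C\,k\log^2 k$, such that on every input graph $G$ on $[k]$ the following holds with probability at least $2/3$: the referee outputs $G$ (all of its edges) if $G$ is distance-hereditary, and rejects if $G$ is not distance-hereditary. -/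

import Mathlib

open scoped Matrix ComplexOrder

/-- The computational basis of a register of `q` qubits: the `2 ^ q` bit strings of length `q`. -/
abbrev QubitBasis (q : ℕ) : Type := Fin q → Bool

/-- A (pure) state of a register whose computational basis is `B`: a unit vector of `ℂ ^ B`. -/
structure PureState (B : Type) [Fintype B] where
  amp : B → ℂ
  norm_one : ∑ b, ‖amp b‖ ^ 2 = 1

/-- A quantum measurement (POVM) with outcomes in `O` on a register with basis `B`:
positive semidefinite matrices, one for each outcome, that sum to the identity. -/
structure Measurement (B O : Type) [Fintype B] [DecidableEq B] [Fintype O] where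
  effect : O → Matrix B B ℂ
  posSemidef : ∀ o, (effect o).PosSemidef
  sum_effect : ∑ o, effect o = 1

/-- Born's rule: the probability `⟨ψ| E_o |ψ⟩` of the outcome `o` when the vector `ψ` is
measured. -/
noncomputable def Measurement.prob {B O : Type} [Fintype B] [DecidableEq B] [Fintype O]
    (M : Measurement B O) (ψ : B → ℂ) (o : O) : ℝ :=
  (star ψ ⬝ᵥ (M.effect o *ᵥ ψ)).re

/-- A quantum simultaneous-message-passing protocol with `k` players, inputs from `X` and outputs
in `O`, without shared randomness or entanglement. Player `v` sends a message of `qubits v` qubits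
whose state depends only on the player and on its own input. The referee, who has no input,
measures all the messages jointly and outputs the outcome. -/
structure QuantumSMP (k : ℕ) (X O : Type) [Fintype O] where
  qubits : Fin k → ℕ
  message : (v : Fin k) → X → PureState (QubitBasis (qubits v))
  referee : Measurement ((v : Fin k) → QubitBasis (qubits v)) O

namespace QuantumSMP

variable {k : ℕ} {X O : Type} [Fintype O]

/-- The communication cost: the total number of qubits sent to the referee. -/
def cost (P : QuantumSMP k X O) : ℕ := ∑ v, P.qubits v

/-- The joint state that the referee receives on the inputs `x`: the tensor product of the players'
messages. -/
noncomputable def jointState (P : QuantumSMP k X O) (x : Fin k → X) :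
    ((v : Fin k) → QubitBasis (P.qubits v)) → ℂ :=
  fun b => ∏ v, (P.message v (x v)).amp (b v)

/-- The probability that the referee outputs `o` on the inputs `x`. -/
noncomputable def outputProb (P : QuantumSMP k X O) (x : Fin k → X) (o : O) : ℝ :=
  P.referee.prob (P.jointState x) o

end QuantumSMP

open Classical in
/-- The neighborhood vector of `v` in `{0,1} ^ k`: the input of player `v` in the number-in-hand
network model. -/
noncomputable def neighborhoodVector {k : ℕ} (G : SimpleGraph (Fin k)) (v : Fin k) :
    Fin k → ZMod 2 :=
  fun u => if G.Adj v u then 1 else 0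

/-- `P` solves the graph problem `f` with bounded error in the number-in-hand network model: on
every graph `G` on the `k` players, where player `v` holds the neighborhood vector of `v`, the
referee outputs `f G` with probability at least `2 / 3`. -/
def QuantumSMP.SolvesNIH {k : ℕ} {O : Type} [Fintype O]
    (P : QuantumSMP k (Fin k → ZMod 2) O) (f : SimpleGraph (Fin k) → O) : Prop :=
  ∀ G : SimpleGraph (Fin k), 2 / 3 ≤ P.outputProb (neighborhoodVector G) (f G)

/-- A graph (connected or not) is distance-hereditary if distances in every connected induced
subgraph agree with distances in the graph. -/
def IsDistanceHereditary {V : Type*} (G : SimpleGraph V) : Prop :=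
  ∀ S : Set V, (G.induce S).Connected →
    ∀ u v : S, (G.induce S).dist u v = G.dist (u : V) (v : V)

open Classical in
/-- The reconstruction task for distance-hereditary graphs: output the graph itself if it is
distance-hereditary, and reject (`none`) otherwise. -/
noncomputable def reconstructDistanceHereditary {k : ℕ} (G : SimpleGraph (Fin k)) :
    Option (SimpleGraph (Fin k)) :=
  if IsDistanceHereditary G then some G else none

/-!
Every distance-hereditary graph with at least two vertices has a pendant or isolated vertex or a
pair of twins. In the last level of a breadth-first search, two vertices in a common component have
the same neighbors in the previous level; so a component with more than one vertex is homogeneous,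
and having a common neighbor it induces a graph without `P₄`, which has twins by Seinsche's theorem.
If the last level is independent, the same applies to a minimal neighborhood of its vertices. Hence
a distance-hereditary graph on `n` vertices is determined by `2 * log n + O(1)` bits per
vertex. As the class is closed under induced subgraphs, at most `(4 * k ^ 2) ^ d` of these graphs
differ from a given graph exactly in the neighborhoods of a prescribed set of `d` players.

Each player sends the fingerprint `∑ a, |a⟩|p(a)⟩` of its input, read as the coefficients of a
polynomial `p` over a field with `Θ(k ^ 4)` elements. Fingerprints of distinct inputs have overlap
`O(k⁻³)`, so the joint states of two graphs that differ at `d` players have overlap `O(k⁻³) ^ d`,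
which outweighs the number of graphs. The joint states of the distance-hereditary graphs are
therefore so close to orthogonal that, by Bombieri's inequality, a constant multiple of the
projections onto them form part of a measurement, which identifies these graphs and rejects all
others with probability at least `2 / 3`.
-/

open SimpleGraph

section GraphDistance

variable {V W : Type*} {G : SimpleGraph V} {H : SimpleGraph W} {r c x : V}

lemma dist_map_le_of_reachable (f : H →g G) {a b : W} (h : H.Reachable a b) :
    G.dist (f a) (f b) ≤ H.dist a b := by
  obtain ⟨p, hp⟩ := h.exists_walk_length_eq_dist
  rw [← hp, ← p.length_map f]
  exact dist_le _

lemma exists_adj_dist_eq_of_dist_eq_succ {n : ℕ} (h : G.dist r x = n + 1) :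
    ∃ s, G.Adj s x ∧ G.dist r s = n := by
  have hreach : G.Reachable r x := .of_dist_ne_zero (by lia)
  obtain ⟨p, hp⟩ := hreach.symm.exists_walk_length_eq_dist
  rw [dist_comm, h] at hp
  cases p with
  | nil => simp at hp
  | @cons _ s _ hxs q =>
    have hle : G.dist r s ≤ n := by
      rw [dist_comm]
      exact (dist_le q).trans (by simpa using hp.le)
    exact ⟨s, hxs.symm, by rcases hxs.diff_dist_adj (u := r) with h' | h' | h' <;> lia⟩

lemma one_lt_dist_of_compl_adj (hrx : Gᶜ.Adj r x) (h : G.Reachable r x) : 1 < G.dist r x :=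
  h.one_lt_dist_of_ne_of_not_adj hrx.ne ((compl_adj _ _ _).1 hrx).2

lemma dist_eq_two_of_compl_adj (hrx : Gᶜ.Adj r x) (hrc : G.Adj r c) (hcx : G.Adj c x) :
    G.dist r x = 2 :=
  le_antisymm (dist_le (.cons hrc (.cons hcx .nil)))
    (one_lt_dist_of_compl_adj hrx (hrc.reachable.trans hcx.reachable))

end GraphDistance

section Twins

variable {V : Type*} {G : SimpleGraph V} {M : Set V}

/-- Two vertices of a graph are twins if they have the same neighbors among the other vertices;
they may or may not be adjacent to each other. -/
def AreTwins (G : SimpleGraph V) (v w : V) : Prop :=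
  ∀ z, z ≠ v → z ≠ w → (G.Adj v z ↔ G.Adj w z)

/-- A set of vertices is homogeneous (also called a module) if the vertices outside it do not
distinguish its members. -/
def IsHomogeneousSet (G : SimpleGraph V) (M : Set V) : Prop :=
  ∀ ⦃z⦄, z ∉ M → ∀ ⦃x⦄, x ∈ M → ∀ ⦃y⦄, y ∈ M → G.Adj z x → G.Adj z y

lemma AreTwins.of_induce (hM : IsHomogeneousSet G M) {x y : M} (h : AreTwins (G.induce M) x y) :
    AreTwins G x y := by
  intro z hzx hzy
  by_cases hz : z ∈ M
  · exact h ⟨z, hz⟩ (Subtype.coe_ne_coe.1 hzx) (Subtype.coe_ne_coe.1 hzy)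
  · rw [G.adj_comm x, G.adj_comm y]
    exact ⟨(hM hz x.2 y.2 ·), (hM hz y.2 x.2 ·)⟩

lemma isHomogeneousSet_of_isCompleteBetween_compl
    (h : G.IsCompleteBetween M Mᶜ ∨ Gᶜ.IsCompleteBetween M Mᶜ) : IsHomogeneousSet G M := by
  intro z hz x hx y hy hzx
  rcases h with h | h
  · exact (h hy hz).symm
  · exact absurd hzx.symm ((compl_adj _ _ _).1 (h hx hz)).2

end Twins

section Cographs

variable {V : Type*} {G : SimpleGraph V} {A B : Set V}

lemma pathGraph_four_isIndContained {a b c d : V} (hab : G.Adj a b) (hbc : G.Adj b c)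
    (hcd : G.Adj c d) (hac : Gᶜ.Adj a c) (had : Gᶜ.Adj a d) (hbd : Gᶜ.Adj b d) :
    pathGraph 4 ⊴ G := by
  have hadj : ∀ i j, G.Adj (![a, b, c, d] i) (![a, b, c, d] j) ↔ (pathGraph 4).Adj i j := by
    rw [compl_adj] at hac had hbd
    intro i j
    rw [pathGraph_adj]
    fin_cases i <;> fin_cases j <;> simp [*, G.adj_comm]
  have hinj : Function.Injective ![a, b, c, d] := by
    intro i j
    fin_cases i <;> fin_cases j <;>
      simp [hab.ne, hbc.ne, hcd.ne, hac.ne, had.ne, hbd.ne, hab.ne', hbc.ne', hcd.ne', hac.ne',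
        had.ne', hbd.ne']
  exact ⟨⟨⟨_, hinj⟩, hadj _ _⟩⟩

/-- A pair of nonempty sets of vertices is anticomplete if the sets are disjoint and no edge joins
them. -/
def IsAnticompletePair (G : SimpleGraph V) (p : Set V × Set V) : Prop :=
  p.1.Nonempty ∧ p.2.Nonempty ∧ Gᶜ.IsCompleteBetween p.1 p.2

lemma IsAnticompletePair.swap (h : IsAnticompletePair G (A, B)) : IsAnticompletePair G (B, A) :=
  ⟨h.2.1, h.1, h.2.2.symm⟩

lemma adj_of_maximalFor_isAnticompletePair (hG : ¬ pathGraph 4 ⊴ G)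
    (hmax : MaximalFor (IsAnticompletePair G) (fun p => p.1 ∪ p.2) (A, B)) {s a : V}
    (hs : s ∉ A ∪ B) (ha : a ∈ A) : G.Adj s a := by
  obtain ⟨⟨-, hB, hAB⟩, hmax⟩ := hmax
  have hgrow : ∀ A' B', IsAnticompletePair G (A', B') → A ∪ B ⊆ A' ∪ B' → s ∉ A' ∪ B' :=
    fun A' B' h hle hs' => hs (hmax h hle hs')
  have hsA : ∀ a ∈ A, s ≠ a := by rintro a ha rfl; exact hs (.inl ha)
  have hsB : ∀ b ∈ B, s ≠ b := by rintro b hb rfl; exact hs (.inr hb)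
  obtain ⟨z, hzB, hsz⟩ : ∃ z ∈ B, G.Adj s z := by
    by_contra! hno
    refine hgrow (insert s A) B ⟨Set.insert_nonempty _ _, hB, ?_⟩ (by grind) (by simp)
    rintro x (rfl | hx) b hb
    · exact (compl_adj _ _ _).2 ⟨hsB b hb, hno b hb⟩
    · exact hAB hx hb
  by_contra hsa
  obtain ⟨x, hxA, hsx, y, hyA, hsy, hxy⟩ :
      ∃ x ∈ A, ¬ G.Adj s x ∧ ∃ y ∈ A, G.Adj s y ∧ G.Adj x y := by
    by_contra! hno
    refine hgrow {x ∈ A | ¬ G.Adj s x} (insert s ({y ∈ A | G.Adj s y} ∪ B))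
      ⟨⟨a, ha, hsa⟩, Set.insert_nonempty _ _, ?_⟩ (by grind) (by simp)
    rintro x ⟨hxA, hsx⟩ y (rfl | ⟨hyA, hsy⟩ | hyB)
    · exact ((compl_adj _ _ _).2 ⟨hsA x hxA, hsx⟩).symm
    · exact (compl_adj _ _ _).2 ⟨by rintro rfl; exact hsx hsy, hno x hxA hsx y hyA hsy⟩
    · exact hAB hxA hyB
  exact hG (pathGraph_four_isIndContained hxy hsy.symm hsz
    ((compl_adj _ _ _).2 ⟨hsA x hxA, hsx⟩).symm (hAB hxA hzB) (hAB hyA hzB))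

/-- Seinsche's theorem: take an anticomplete pair covering as many vertices as possible; the
remaining vertices, if any, are joined to all of the covered ones. -/
theorem exists_isCompleteBetween_compl_of_not_pathGraph_four_isIndContained [Finite V]
    [Nontrivial V] (hG : ¬ pathGraph 4 ⊴ G) :
    ∃ A : Set V, A.Nonempty ∧ Aᶜ.Nonempty ∧
      (G.IsCompleteBetween A Aᶜ ∨ Gᶜ.IsCompleteBetween A Aᶜ) := by
  by_cases hpair : ∃ p, IsAnticompletePair G p
  · obtain ⟨⟨A, B⟩, hmax⟩ :=
      Set.Finite.exists_maximalFor (fun p => p.1 ∪ p.2) {p | IsAnticompletePair G p}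
        (Set.toFinite _) hpair
    obtain ⟨hA, hB, hAB⟩ := hmax.prop
    by_cases hcover : (A ∪ B)ᶜ.Nonempty
    · have hmax' : MaximalFor (IsAnticompletePair G) (fun p => p.1 ∪ p.2) (B, A) :=
        ⟨hmax.prop.swap, fun p hp hle => by
          simpa only [Set.union_comm B] using
            hmax.le_of_le hp (by simpa only [Set.union_comm A] using hle)⟩
      refine ⟨A ∪ B, hA.inl, hcover, .inl ?_⟩
      rintro x (hx | hx) s hs
      · exact (adj_of_maximalFor_isAnticompletePair hG hmax hs hx).symm
      · exact (adj_of_maximalFor_isAnticompletePair hG hmax' (by rwa [Set.union_comm]) hx).symm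
    · have hcompl : Aᶜ = B := by
        rw [Set.nonempty_compl, not_not] at hcover
        exact (isCompl_iff.2 ⟨hAB.disjoint, codisjoint_iff.2 hcover⟩).compl_eq
      exact ⟨A, hA, hcompl ▸ hB, .inr (hcompl ▸ hAB)⟩
  · obtain ⟨v, w, hvw⟩ := exists_pair_ne V
    refine ⟨{v}, Set.singleton_nonempty v, ⟨w, hvw.symm⟩, .inl ?_⟩
    intro v' hv' x hx
    rw [Set.mem_singleton_iff.1 hv']
    by_contra hvx
    refine hpair ⟨({v}, {x}), Set.singleton_nonempty v, Set.singleton_nonempty x, ?_⟩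
    rintro _ rfl _ rfl
    exact (compl_adj _ _ _).2 ⟨Ne.symm hx, hvx⟩

theorem exists_areTwins_of_not_pathGraph_four_isIndContained {V : Type*} {G : SimpleGraph V}
    [Finite V] [Nontrivial V] (hG : ¬ pathGraph 4 ⊴ G) : ∃ v w, v ≠ w ∧ AreTwins G v w := by
  induction hn : Nat.card V using Nat.strong_induction_on generalizing V with
  | h n ih =>
    obtain ⟨A, hA, hAc, h⟩ :=
      exists_isCompleteBetween_compl_of_not_pathGraph_four_isIndContained hG
    have twins_of_nontrivial : ∀ M : Set V, M.Nontrivial → M ≠ Set.univ → IsHomogeneousSet G M →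
        ∃ v w, v ≠ w ∧ AreTwins G v w := by
      intro M hnt hne hM
      have := hnt.coe_sort
      obtain ⟨v, w, hvw, ht⟩ := ih (Nat.card M) (by simpa [← hn] using Set.ncard_lt_card hne)
        (fun hP => hG (hP.trans ⟨Embedding.induce M⟩)) rfl
      exact ⟨v, w, Subtype.coe_ne_coe.2 hvw, ht.of_induce hM⟩
    by_cases hA' : A.Nontrivial
    · exact twins_of_nontrivial A hA' (Set.nonempty_compl.1 hAc)
        (isHomogeneousSet_of_isCompleteBetween_compl h)
    by_cases hAc' : Aᶜ.Nontrivial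
    · refine twins_of_nontrivial Aᶜ hAc' (by simpa using hA.ne_empty)
        (isHomogeneousSet_of_isCompleteBetween_compl ?_)
      rw [compl_compl]
      exact h.imp (IsCompleteBetween.symm _) (IsCompleteBetween.symm _)
    · obtain ⟨v, hv⟩ := hA
      obtain ⟨w, hw⟩ := hAc
      rw [Set.not_nontrivial_iff] at hA' hAc'
      refine ⟨v, w, by rintro rfl; exact hw hv, fun z hzv hzw => ?_⟩
      by_cases hz : z ∈ A
      · exact absurd (hA' hz hv) hzv
      · exact absurd (hAc' hz hw) hzw

end Cographs

section DistanceLevels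

variable {V : Type*} {G : SimpleGraph V} {r t v x y : V} {i : ℕ}

lemma exists_walk_avoiding_dist_level (hrt : G.Reachable r t) :
    ∃ p : G.Walk r t, ∀ z ∈ p.support, z = t ∨ G.dist r z ≠ G.dist r t := by
  classical
  obtain ⟨p, hp⟩ := hrt.exists_walk_length_eq_dist
  refine ⟨p, fun z hz => or_iff_not_imp_left.2 fun hzt => ne_of_lt ?_⟩
  rw [← hp]
  exact (dist_le (p.takeUntil z hz)).trans_lt (p.length_takeUntil_lt_length hz hzt)

lemma dist_eq_of_adj_of_independent_last_level (hmax : ∀ z, G.dist r z ≤ i + 1)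
    (hind : ∀ v w, G.dist r v = i + 1 → G.dist r w = i + 1 → ¬ G.Adj v w)
    (hv : G.dist r v = i + 1) (hvx : G.Adj v x) : G.dist r x = i := by
  have hx : G.dist r x ≠ i + 1 := fun hx => hind v x hv hx hvx
  have := hmax x
  rcases hvx.diff_dist_adj (u := r) with h | h | h <;> lia

lemma compl_adj_of_dist_add_one_lt (h : G.dist r x + 1 < G.dist r y) : Gᶜ.Adj x y := by
  refine (compl_adj _ _ _).2 ⟨by rintro rfl; lia, fun hxy => ?_⟩
  rcases hxy.diff_dist_adj (u := r) with h | h | h <;> lia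

end DistanceLevels

namespace IsDistanceHereditary

variable {V W : Type*} {G : SimpleGraph V} {H : SimpleGraph W}

lemma dist_eq_of_connected (hG : IsDistanceHereditary G) (f : H ↪g G) (hH : H.Connected)
    (a b : W) : H.dist a b = G.dist (f a) (f b) := by
  have hconn := f.isoInduceRange.connected_iff.1 hH
  refine le_antisymm ?_ (dist_map_le_of_reachable f.toHom (hH a b))
  calc H.dist a b
      = H.dist (f.isoInduceRange.symm (f.isoInduceRange a))
          (f.isoInduceRange.symm (f.isoInduceRange b)) := by simp only [RelIso.symm_apply_apply]
    _ ≤ (G.induce (Set.range f)).dist (f.isoInduceRange a) (f.isoInduceRange b) :=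
        dist_map_le_of_reachable f.isoInduceRange.symm.toHom (hconn _ _)
    _ = G.dist (f a) (f b) := hG _ hconn _ _

lemma dist_embedding (hG : IsDistanceHereditary G) (f : H ↪g G) {a b : W}
    (hab : H.Reachable a b) : H.dist a b = G.dist (f a) (f b) := by
  let C := H.connectedComponentMk a
  have hb : b ∈ C.supp := ConnectedComponent.sound hab.symm
  have hC : (H.induce C.supp).Connected := C.connected_toSimpleGraph
  refine le_antisymm ?_ (dist_map_le_of_reachable f.toHom hab)
  calc H.dist a b
      ≤ (H.induce C.supp).dist ⟨a, rfl⟩ ⟨b, hb⟩ :=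
        dist_map_le_of_reachable (Embedding.induce C.supp).toHom (hC ⟨a, rfl⟩ ⟨b, hb⟩)
    _ = G.dist (f a) (f b) := hG.dist_eq_of_connected (f.comp (Embedding.induce C.supp)) hC _ _

lemma induce (hG : IsDistanceHereditary G) (S : Set V) : IsDistanceHereditary (G.induce S) := by
  intro T hT u v
  have hreach := (hT u v).map (Embedding.induce (G := G.induce S) T).toHom
  exact (hG.dist_eq_of_connected ((Embedding.induce S).comp (Embedding.induce T)) hT u v).trans
    (hG.dist_embedding (Embedding.induce S) hreach).symm

lemma adj_of_reachable_induce (hG : IsDistanceHereditary G) {r t : V} {i : ℕ}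
    (ht : G.dist r t = i) {x y : {z | i < G.dist r z}} (htx : G.Adj t x)
    (hy : G.dist r y = i + 1) (hxy : (G.induce {z | i < G.dist r z}).Reachable x y) :
    G.Adj t y := by
  have hrt : G.Reachable r t := by
    have hry : G.Reachable r y := .of_dist_ne_zero (by lia)
    exact hry.trans ((hxy.map (Embedding.induce _).toHom).symm.trans htx.symm.reachable)
  let S : Set V := {z | z = t ∨ G.dist r z ≠ i}
  have hupper : {z | i < G.dist r z} ⊆ S := fun z hz => .inr (ne_of_gt hz)
  have hxy' : (G.induce S).Reachable (Set.inclusion hupper x) (Set.inclusion hupper y) :=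
    hxy.map (G.induceHomOfLE hupper).toHom
  obtain ⟨p, hp⟩ := exists_walk_avoiding_dist_level hrt
  have hpS : ∀ z ∈ p.support, z ∈ S := by rwa [ht] at hp
  have hry : (G.induce S).Reachable ⟨r, hpS _ p.start_mem_support⟩ (Set.inclusion hupper y) :=
    (p.induce S hpS).reachable.trans
      ((show (G.induce S).Adj ⟨t, .inl rfl⟩ (Set.inclusion hupper x) from htx).reachable.trans hxy')
  have hdist := hG.dist_embedding (Embedding.induce S) hry
  obtain ⟨s, hsy, hs⟩ := exists_adj_dist_eq_of_dist_eq_succ (hdist.trans hy)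
  have hrs := hG.dist_embedding (Embedding.induce S) (hry.trans hsy.symm.reachable)
  rcases s.2 with hst | hsi
  · exact hst ▸ hsy
  · exact absurd (hrs.symm.trans hs) hsi

section CommonNeighbors

variable {r c d t w x y : V} {i : ℕ}

lemma adj_of_adj_of_dist_eq (hG : IsDistanceHereditary G) (ht : G.dist r t = i) (htx : G.Adj t x)
    (hx : i < G.dist r x) (hy : G.dist r y = i + 1) (hxy : G.Adj x y) : G.Adj t y := by
  have hxy' : (G.induce {z | i < G.dist r z}).Adj ⟨x, hx⟩ ⟨y, by grind⟩ := hxy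
  exact hG.adj_of_reachable_induce ht htx hy hxy'.reachable

lemma adj_of_adj_of_adj_of_dist_eq (hG : IsDistanceHereditary G) (ht : G.dist r t = i)
    (htx : G.Adj t x) (hx : i < G.dist r x) (hw : i < G.dist r w) (hy : G.dist r y = i + 1)
    (hxw : G.Adj x w) (hwy : G.Adj w y) : G.Adj t y := by
  have hxw' : (G.induce {z | i < G.dist r z}).Adj ⟨x, hx⟩ ⟨w, hw⟩ := hxw
  have hwy' : (G.induce {z | i < G.dist r z}).Adj ⟨w, hw⟩ ⟨y, by grind⟩ := hwy
  exact hG.adj_of_reachable_induce ht htx hy (hxw'.reachable.trans hwy'.reachable)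

lemma adj_of_common_neighbor_of_adj (hG : IsDistanceHereditary G) (hrx : Gᶜ.Adj r x)
    (hry : Gᶜ.Adj r y) (hrc : G.Adj r c) (hcx : G.Adj c x) (hrd : G.Adj r d) (hdy : G.Adj d y)
    (hxy : G.Adj x y) : G.Adj c y :=
  hG.adj_of_adj_of_dist_eq (dist_eq_one_iff_adj.2 hrc) hcx
    (one_lt_dist_of_compl_adj hrx (hrc.reachable.trans hcx.reachable))
    (dist_eq_two_of_compl_adj hry hrd hdy) hxy

lemma adj_of_common_neighbor (hG : IsDistanceHereditary G) (hrx : Gᶜ.Adj r x)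
    (hry : Gᶜ.Adj r y) (hrw : Gᶜ.Adj r w) (hrc : G.Adj r c) (hcx : G.Adj c x) (hrd : G.Adj r d)
    (hdy : G.Adj d y) (hxw : G.Adj x w) (hwy : G.Adj w y) : G.Adj c y := by
  have hreach : G.Reachable r x := hrc.reachable.trans hcx.reachable
  exact hG.adj_of_adj_of_adj_of_dist_eq (dist_eq_one_iff_adj.2 hrc) hcx
    (one_lt_dist_of_compl_adj hrx hreach)
    (one_lt_dist_of_compl_adj hrw (hreach.trans hxw.reachable))
    (dist_eq_two_of_compl_adj hry hrd hdy) hxw hwy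

end CommonNeighbors

lemma not_pathGraph_four_isIndContained (hG : IsDistanceHereditary G) {M : Set V} {h : V}
    (hM : ∀ x ∈ M, G.Adj h x) : ¬ pathGraph 4 ⊴ G.induce M := by
  rintro ⟨f⟩
  have hadj : ∀ i j, G.Adj (f i) (f j) ↔ (pathGraph 4).Adj i j := fun i j => f.map_adj_iff
  have hcompl : ∀ i j, Gᶜ.Adj (f i) (f j) ↔ (pathGraph 4)ᶜ.Adj i j := by
    simp [compl_adj, hadj, Subtype.coe_inj]
  have h13 := hG.adj_of_common_neighbor_of_adj (r := (f 0 : V)) (c := f 1)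
    (d := h) (x := f 2) (y := f 3)
    (by simp [hcompl, compl_adj, pathGraph_adj]) (by simp [hcompl, compl_adj, pathGraph_adj])
    (by simp [hadj, pathGraph_adj]) (by simp [hadj, pathGraph_adj]) (hM _ (f 0).2).symm
    (hM _ (f 3).2) (by simp [hadj, pathGraph_adj])
  simp [hadj, pathGraph_adj] at h13

lemma exists_areTwins_of_isHomogeneousSet [Finite V] (hG : IsDistanceHereditary G) {M : Set V}
    {h : V} (hM : IsHomogeneousSet G M) (hnt : M.Nontrivial) (hh : ∀ x ∈ M, G.Adj h x) :
    ∃ v w, v ≠ w ∧ AreTwins G v w := by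
  have := hnt.coe_sort
  obtain ⟨v, w, hvw, htwins⟩ := exists_areTwins_of_not_pathGraph_four_isIndContained
    (hG.not_pathGraph_four_isIndContained hh)
  exact ⟨v, w, Subtype.coe_ne_coe.2 hvw, htwins.of_induce hM⟩

section LastLevel

variable {u : V} {i : ℕ}

lemma isHomogeneousSet_component_last_level (hG : IsDistanceHereditary G)
    (hmax : ∀ z, G.dist u z ≤ i + 1)
    (C : (G.induce {z | i < G.dist u z}).ConnectedComponent) :
    IsHomogeneousSet G (Subtype.val '' C.supp) := by
  rintro z hz _ ⟨x, hxC, rfl⟩ _ ⟨y, hyC, rfl⟩ hzx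
  have hx := x.2
  have hy := y.2
  have hz' : ¬ i < G.dist u z := fun hiz =>
    hz ⟨⟨z, hiz⟩, C.mem_supp_of_adj_mem_supp (v := ⟨z, hiz⟩) hxC hzx.symm, rfl⟩
  have hzi : G.dist u z = i := by
    have := hzx.diff_dist_adj (u := u)
    grind
  exact hG.adj_of_reachable_induce hzi hzx (le_antisymm (hmax y) hy)
    (C.reachable_of_mem_supp hxC hyC)

lemma exists_areTwins_of_adj_last_level [Finite V] (hG : IsDistanceHereditary G) {v w : V}
    (hmax : ∀ z, G.dist u z ≤ i + 1) (hv : G.dist u v = i + 1) (hw : G.dist u w = i + 1)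
    (hvw : G.Adj v w) : ∃ v w, v ≠ w ∧ AreTwins G v w := by
  let U : Set V := {z | i < G.dist u z}
  let v' : U := ⟨v, by grind⟩
  let w' : U := ⟨w, by grind⟩
  let C := (G.induce U).connectedComponentMk v'
  have hwC : w' ∈ C.supp :=
    C.mem_supp_of_adj_mem_supp ConnectedComponent.connectedComponentMk_mem hvw
  obtain ⟨t, htv, ht⟩ := exists_adj_dist_eq_of_dist_eq_succ hv
  refine hG.exists_areTwins_of_isHomogeneousSet (h := t)
    (hG.isHomogeneousSet_component_last_level hmax C)
    ⟨v, ⟨v', rfl, rfl⟩, w, ⟨w', hwC, rfl⟩, hvw.ne⟩ ?_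
  rintro _ ⟨x, hxC, rfl⟩
  exact hG.adj_of_reachable_induce ht htv (le_antisymm (hmax x) x.2)
    (C.reachable_of_mem_supp ConnectedComponent.connectedComponentMk_mem hxC)

end LastLevel

section IndependentLastLevel

variable {u v x y z : V} {i j : ℕ}

lemma adj_of_dist_eq_of_adj_upper (hG : IsDistanceHereditary G) (hv : G.dist u v = j + 2)
    (hx : G.dist u x = j + 1) (hy : G.dist u y = j + 1) (hz : G.dist u z = j + 1)
    (hvx : G.Adj v x) (hvy : G.Adj v y) (hvz : ¬ G.Adj v z) (hzx : G.Adj z x) : G.Adj z y := by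
  obtain ⟨t, htx, ht⟩ := exists_adj_dist_eq_of_dist_eq_succ hx
  have hty : G.Adj t y :=
    hG.adj_of_adj_of_adj_of_dist_eq ht htx (by lia) (by lia) hy hvx.symm hvy
  have htz : G.Adj t z := hG.adj_of_adj_of_dist_eq ht htx (by lia) hz hzx.symm
  by_contra hzy
  have hzy' : Gᶜ.Adj z y := (compl_adj _ _ _).2 ⟨by rintro rfl; exact hvz hvy, hzy⟩
  have hzv : Gᶜ.Adj z v := (compl_adj _ _ _).2 ⟨by rintro rfl; lia, fun h => hvz h.symm⟩
  have htv : G.Adj t v :=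
    hG.adj_of_common_neighbor_of_adj hzy' hzv htz.symm hty hzx hvx.symm hvy.symm
  exact ((compl_adj _ _ _).1 (compl_adj_of_dist_add_one_lt (r := u) (by lia))).2 htv

lemma adj_of_dist_eq_of_adj_lower (hG : IsDistanceHereditary G) {b : V} (hv : G.dist u v = j + 2)
    (hz : G.dist u z = j + 2) (hx : G.dist u x = j + 1) (hy : G.dist u y = j + 1)
    (hb : G.dist u b = j + 1) (hvx : G.Adj v x) (hvy : G.Adj v y) (hvz : Gᶜ.Adj v z)
    (hzx : G.Adj z x) (hzb : G.Adj z b) (hvb : ¬ G.Adj v b) : G.Adj z y := by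
  obtain ⟨t, htx, ht⟩ := exists_adj_dist_eq_of_dist_eq_succ hx
  have hty : G.Adj t y :=
    hG.adj_of_adj_of_adj_of_dist_eq ht htx (by lia) (by lia) hy hvx.symm hvy
  have htb : G.Adj t b :=
    hG.adj_of_adj_of_adj_of_dist_eq ht htx (by lia) (by lia) hb hzx.symm hzb
  have hzt : Gᶜ.Adj z t := (compl_adj_of_dist_add_one_lt (r := u) (by lia)).symm
  by_contra hzy
  have hzy' : Gᶜ.Adj z y := (compl_adj _ _ _).2 ⟨by rintro rfl; lia, hzy⟩
  exact hvb (hG.adj_of_common_neighbor hzt hvz.symm hzy' hzb htb.symm hzx hvx.symm hty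
    hvy.symm).symm

lemma isHomogeneousSet_neighborSet (hG : IsDistanceHereditary G)
    (hmax : ∀ z, G.dist u z ≤ j + 2)
    (hind : ∀ v w, G.dist u v = j + 2 → G.dist u w = j + 2 → ¬ G.Adj v w)
    (hv : MinimalFor (fun v => G.dist u v = j + 2) G.neighborSet v) :
    IsHomogeneousSet G (G.neighborSet v) := by
  have hlevel : ∀ {w b}, G.dist u w = j + 2 → G.Adj w b → G.dist u b = j + 1 :=
    fun hw hwb => dist_eq_of_adj_of_independent_last_level hmax hind hw hwb
  intro z hvz x hvx y hvy hzx
  rw [mem_neighborSet] at hvz hvx hvy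
  have hx := hlevel hv.prop hvx
  have hy := hlevel hv.prop hvy
  obtain hz | hz | hz : G.dist u z = j ∨ G.dist u z = j + 1 ∨ G.dist u z = j + 2 := by
    have := hzx.diff_dist_adj (u := u)
    grind
  · exact hG.adj_of_adj_of_adj_of_dist_eq hz hzx (by lia) (by grind [hv.prop]) hy hvx.symm hvy
  · exact hG.adj_of_dist_eq_of_adj_upper hv.prop hx hy hz hvx hvy hvz hzx
  · by_cases hsub : G.neighborSet z ⊆ G.neighborSet v
    · exact hv.le_of_le hz hsub hvy
    · obtain ⟨b, hzb, hvb⟩ := Set.not_subset.1 hsub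
      have hvz' : Gᶜ.Adj v z := (compl_adj _ _ _).2 ⟨by rintro rfl; exact hvb hzb, hvz⟩
      exact hG.adj_of_dist_eq_of_adj_lower hv.prop hz hx hy (hlevel hz hzb) hvx hvy hvz' hzx hzb
        hvb

lemma exists_pendant_or_areTwins_of_independent_last_level [Finite V] (hG : IsDistanceHereditary G)
    (hmax : ∀ z, G.dist u z ≤ i + 1) (hx : G.dist u x = i + 1)
    (hind : ∀ v w, G.dist u v = i + 1 → G.dist u w = i + 1 → ¬ G.Adj v w) :
    ∃ v w, v ≠ w ∧ (G.neighborSet v ⊆ {w} ∨ AreTwins G v w) := by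
  obtain ⟨v, hv⟩ := Set.Finite.exists_minimalFor G.neighborSet {v | G.dist u v = i + 1}
    (Set.toFinite _) ⟨x, hx⟩
  cases i with
  | zero =>
    have hvu : G.Reachable u v := .of_dist_ne_zero (by grind [hv.prop])
    refine ⟨v, u, by rintro rfl; simpa using hv.prop, .inl fun y hvy => ?_⟩
    exact ((hvu.trans hvy.reachable).dist_eq_zero_iff.1
      (dist_eq_of_adj_of_independent_last_level hmax hind hv.prop hvy)).symm
  | succ j =>
    by_cases hnt : (G.neighborSet v).Nontrivial
    · obtain ⟨a, b, hab, htwins⟩ := hG.exists_areTwins_of_isHomogeneousSet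
        (hG.isHomogeneousSet_neighborSet hmax hind hv) hnt fun _ h => h
      exact ⟨a, b, hab, .inr htwins⟩
    · obtain ⟨p, hpv, -⟩ := exists_adj_dist_eq_of_dist_eq_succ hv.prop
      exact ⟨v, p, hpv.ne', .inl fun y hy => Set.not_nontrivial_iff.1 hnt hy hpv.symm⟩

end IndependentLastLevel

theorem exists_pendant_or_areTwins [Finite V] [Nontrivial V] (hG : IsDistanceHereditary G) :
    ∃ v w, v ≠ w ∧ (G.neighborSet v ⊆ {w} ∨ AreTwins G v w) := by
  obtain ⟨u, u', huu'⟩ := exists_pair_ne V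
  obtain ⟨x, hmax⟩ := Finite.exists_max (G.dist u)
  cases hx : G.dist u x with
  | zero =>
    refine ⟨u, u', huu', .inl fun z huz => ?_⟩
    have := dist_eq_one_iff_adj.2 huz
    have := hmax z
    lia
  | succ i =>
    rw [hx] at hmax
    by_cases hind : ∀ v w, G.dist u v = i + 1 → G.dist u w = i + 1 → ¬ G.Adj v w
    · exact hG.exists_pendant_or_areTwins_of_independent_last_level hmax hx hind
    · push Not at hind
      obtain ⟨v, w, hv, hw, hvw⟩ := hind
      obtain ⟨a, b, hab, htwins⟩ := hG.exists_areTwins_of_adj_last_level hmax hv hw hvw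
      exact ⟨a, b, hab, .inr htwins⟩

end IsDistanceHereditary

section Counting

variable {V : Type*} {G G' : SimpleGraph V} {v w : V} {b c : Bool}

/-- `G` arises from `G - v` by adding the vertex `v` either as a vertex without neighbors other than
`w` (if `c` is `false`) or as a twin of `w` (if `c` is `true`). The bit `b` tells whether `v` and
`w` are adjacent. -/
def IsOneVertexExtension (G : SimpleGraph V) (v w : V) (b c : Bool) : Prop :=
  v ≠ w ∧ (G.Adj v w ↔ b) ∧ ∀ z, z ≠ v → z ≠ w → (G.Adj v z ↔ c ∧ G.Adj w z)

lemma IsOneVertexExtension.eq_of_induce_eq (hG : IsOneVertexExtension G v w b c)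
    (hG' : IsOneVertexExtension G' v w b c) (h : G.induce {v}ᶜ = G'.induce {v}ᶜ) : G = G' := by
  obtain ⟨hvw, hb, hc⟩ := hG
  obtain ⟨-, hb', hc'⟩ := hG'
  have hoff : ∀ x y, x ≠ v → y ≠ v → (G.Adj x y ↔ G'.Adj x y) := fun x y hx hy =>
    iff_of_eq (congrArg (fun K => K.Adj ⟨x, hx⟩ ⟨y, hy⟩) h)
  have hat : ∀ z, G.Adj v z ↔ G'.Adj v z := by
    intro z
    by_cases hzv : z = v
    · simp only [hzv, SimpleGraph.irrefl]
    by_cases hzw : z = w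
    · rw [hzw, hb, hb']
    · rw [hc z hzv hzw, hc' z hzv hzw, hoff w z hvw.symm hzv]
  ext x y
  by_cases hx : x = v
  · exact hx ▸ hat y
  by_cases hy : y = v
  · rw [G.adj_comm, G'.adj_comm, hy]
    exact hat x
  · exact hoff x y hx hy

lemma IsDistanceHereditary.exists_isOneVertexExtension [Finite V] [Nontrivial V]
    (hG : IsDistanceHereditary G) : ∃ v w b c, IsOneVertexExtension G v w b c := by
  classical
  obtain ⟨v, w, hvw, hpendant | htwins⟩ := hG.exists_pendant_or_areTwins
  · exact ⟨v, w, decide (G.Adj v w), false, hvw, by simp, fun z _ hzw => by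
      simpa using fun hvz => hzw (hpendant hvz)⟩
  · exact ⟨v, w, decide (G.Adj v w), true, hvw, by simp, fun z hzv hzw => by
      simpa using htwins z hzv hzw⟩

lemma card_isOneVertexExtension_le {V : Type*} [Finite V] (v w : V) (b c : Bool) :
    Nat.card {G : SimpleGraph V // IsDistanceHereditary G ∧ IsOneVertexExtension G v w b c} ≤
      Nat.card {K : SimpleGraph ({v}ᶜ : Set V) // IsDistanceHereditary K} := by
  refine Nat.card_le_card_of_injective (fun G => ⟨G.1.induce {v}ᶜ, G.2.1.induce _⟩) ?_
  intro G G' h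
  exact Subtype.ext (G.2.2.eq_of_induce_eq G'.2.2 (congrArg Subtype.val h))

theorem card_isDistanceHereditary_le {V : Type*} [Finite V] :
    Nat.card {G : SimpleGraph V // IsDistanceHereditary G} ≤
      (4 * Nat.card V ^ 2) ^ Nat.card V := by
  induction hn : Nat.card V generalizing V with
  | zero =>
    have := (Nat.card_eq_zero.1 hn).resolve_right (not_infinite_iff_finite.2 ‹_›)
    exact Finite.card_le_one_iff_subsingleton.2 inferInstance
  | succ n ih =>
    rcases subsingleton_or_nontrivial V with hV | hV
    · exact (Finite.card_le_one_iff_subsingleton.2 inferInstance).trans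
        (Nat.one_le_pow _ _ (by positivity))
    have := Fintype.ofFinite V
    let Extension (d : V × V × Bool × Bool) : Type _ :=
      {G : SimpleGraph V //
        IsDistanceHereditary G ∧ IsOneVertexExtension G d.1 d.2.1 d.2.2.1 d.2.2.2}
    have hsurj : Function.Surjective
        (fun G => ⟨G.2.1, G.2.2.1⟩ :
          (Σ d, Extension d) → {G : SimpleGraph V // IsDistanceHereditary G}) := by
      rintro ⟨G, hG⟩
      obtain ⟨v, w, b, c, hext⟩ := hG.exists_isOneVertexExtension
      exact ⟨⟨(v, w, b, c), G, hG, hext⟩, rfl⟩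
    have hcompl : ∀ v : V, Nat.card ({v}ᶜ : Set V) = n := fun v => by
      rw [Nat.card_coe_set_eq, Set.ncard_compl, Set.ncard_singleton, hn, Nat.add_sub_cancel]
    calc Nat.card {G : SimpleGraph V // IsDistanceHereditary G}
        ≤ ∑ d, Nat.card (Extension d) := by
          rw [← Nat.card_sigma]
          exact Nat.card_le_card_of_surjective _ hsurj
      _ ≤ ∑ _d : V × V × Bool × Bool, (4 * n ^ 2) ^ n :=
          Finset.sum_le_sum fun d _ =>
            (card_isOneVertexExtension_le _ _ _ _).trans (ih (hcompl d.1))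
      _ = 4 * (n + 1) ^ 2 * (4 * n ^ 2) ^ n := by
          simp only [Finset.sum_const, Finset.card_univ, Fintype.card_prod, Fintype.card_bool,
            ← Nat.card_eq_fintype_card (α := V), hn, smul_eq_mul]
          ring
      _ ≤ (4 * (n + 1) ^ 2) ^ (n + 1) := by
          rw [pow_succ' _ n]
          gcongr
          lia

end Counting

section Disagreement

variable {V : Type*} [Fintype V] {G G' H : SimpleGraph V} {v : V}

open Classical in
/-- The set of vertices whose neighborhoods in the two graphs differ, that is, of the players that
send different messages on the two graphs. -/
noncomputable def disagreement (G H : SimpleGraph V) : Finset V :=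
  {v | G.neighborSet v ≠ H.neighborSet v}

lemma notMem_disagreement : v ∉ disagreement G H ↔ G.neighborSet v = H.neighborSet v := by
  simp [disagreement]

lemma disagreement_eq_empty : disagreement G H = ∅ ↔ G = H := by
  refine ⟨fun h => ?_, fun h => by simp [h, disagreement]⟩
  ext x y
  exact Set.ext_iff.1 (notMem_disagreement.1 (h ▸ Finset.notMem_empty x)) y

lemma eq_of_induce_disagreement_eq (hdis : disagreement G H = disagreement G' H)
    (h : G.induce (disagreement G H : Set V) = G'.induce (disagreement G H : Set V)) :
    G = G' := by
  have hoff : ∀ x ∉ disagreement G H, ∀ y, G.Adj x y ↔ G'.Adj x y := fun x hx =>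
    Set.ext_iff.1 ((notMem_disagreement.1 hx).trans (notMem_disagreement.1 (hdis ▸ hx)).symm)
  ext x y
  by_cases hx : x ∈ disagreement G H
  · by_cases hy : y ∈ disagreement G H
    · exact iff_of_eq (congrArg (fun K => K.Adj ⟨x, hx⟩ ⟨y, hy⟩) h)
    · rw [G.adj_comm, G'.adj_comm, hoff y hy]
  · exact hoff x hx y

open Classical in
lemma card_filter_disagreement_eq_le (𝒢 : Finset (SimpleGraph V)) (H : SimpleGraph V)
    (D : Finset V) :
    (𝒢.filter fun G => disagreement G H = D).card ≤
      (𝒢.image fun G => G.induce (D : Set V)).card := by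
  refine Finset.card_le_card_of_injOn (fun G => G.induce (D : Set V)) ?_ ?_
  · exact fun G hG => Finset.mem_coe.2 (Finset.mem_image_of_mem _ (Finset.mem_filter.1 hG).1)
  · intro G hG G' hG' h
    obtain rfl := (Finset.mem_filter.1 hG).2
    exact eq_of_induce_disagreement_eq (Finset.mem_filter.1 hG').2.symm h

open Classical in
theorem sum_pow_card_disagreement_le {𝒢 : Finset (SimpleGraph V)} {B δ : ℝ} (hδ : 0 ≤ δ)
    (h𝒢 : ∀ D : Finset V, (𝒢.image fun G => G.induce (D : Set V)).card ≤ B ^ D.card)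
    (H : SimpleGraph V) :
    ∑ G ∈ 𝒢.erase H, δ ^ (disagreement G H).card ≤ (B * δ + 1) ^ Fintype.card V - 1 := by
  have hmaps : ∀ G ∈ 𝒢.erase H, disagreement G H ∈ (Finset.univ : Finset (Finset V)).erase ∅ := by
    intro G hG
    exact Finset.mem_erase.2
      ⟨disagreement_eq_empty.not.2 (Finset.ne_of_mem_erase hG), Finset.mem_univ _⟩
  calc ∑ G ∈ 𝒢.erase H, δ ^ (disagreement G H).card
      = ∑ D ∈ (Finset.univ : Finset (Finset V)).erase ∅, ∑ G ∈ 𝒢.erase H with disagreement G H = D,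
          δ ^ (disagreement G H).card := (Finset.sum_fiberwise_of_maps_to hmaps _).symm
    _ = ∑ D ∈ (Finset.univ : Finset (Finset V)).erase ∅,
          ((𝒢.erase H).filter fun G => disagreement G H = D).card * δ ^ D.card := by
        refine Finset.sum_congr rfl fun D _ => ?_
        rw [← nsmul_eq_mul, ← Finset.sum_const]
        exact Finset.sum_congr rfl fun G hG => by rw [(Finset.mem_filter.1 hG).2]
    _ ≤ ∑ D ∈ (Finset.univ : Finset (Finset V)).erase ∅, (B * δ) ^ D.card := by
        refine Finset.sum_le_sum fun D _ => ?_
        rw [mul_pow]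
        gcongr
        refine le_trans ?_ (h𝒢 D)
        exact_mod_cast (Finset.card_le_card (Finset.filter_subset_filter _
          (Finset.erase_subset _ _))).trans (card_filter_disagreement_eq_le 𝒢 H D)
    _ = (B * δ + 1) ^ Fintype.card V - 1 := by
        rw [Finset.sum_erase_eq_sub (Finset.mem_univ _), Finset.card_empty, pow_zero]
        simp only [← Fintype.sum_pow_mul_eq_add_pow, one_pow, mul_one]

variable (V) in
open Classical in
/-- The distance-hereditary graphs with vertex set `V`, that is, the inputs that the referee has to
tell apart. -/
noncomputable def distanceHereditaryGraphs : Finset (SimpleGraph V) :=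
  {G | IsDistanceHereditary G}

lemma mem_distanceHereditaryGraphs : G ∈ distanceHereditaryGraphs V ↔ IsDistanceHereditary G := by
  simp only [distanceHereditaryGraphs, Finset.mem_filter_univ]

lemma card_distanceHereditaryGraphs_le :
    (distanceHereditaryGraphs V).card ≤ (4 * Fintype.card V ^ 2) ^ Fintype.card V := by
  classical
  simpa only [distanceHereditaryGraphs, Nat.card_eq_fintype_card, Fintype.card_subtype]
    using card_isDistanceHereditary_le (V := V)

open Classical in
lemma card_image_induce_distanceHereditaryGraphs_le (D : Finset V) :
    ((distanceHereditaryGraphs V).image fun G => G.induce (D : Set V)).card ≤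
      (4 * Fintype.card V ^ 2) ^ D.card := by
  calc ((distanceHereditaryGraphs V).image fun G => G.induce (D : Set V)).card
      ≤ (distanceHereditaryGraphs (D : Set V)).card := by
        refine Finset.card_le_card fun K hK => ?_
        obtain ⟨G, hG, rfl⟩ := Finset.mem_image.1 hK
        exact mem_distanceHereditaryGraphs.2 ((mem_distanceHereditaryGraphs.1 hG).induce _)
    _ ≤ (4 * D.card ^ 2) ^ D.card := by
        simpa only [Finset.coe_sort_coe, Fintype.card_coe]
          using card_distanceHereditaryGraphs_le (V := (D : Set V))
    _ ≤ (4 * Fintype.card V ^ 2) ^ D.card := by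
        gcongr
        exact Finset.card_le_univ D

lemma one_add_pow_le_three_halves {c : ℝ} {n : ℕ} (hc : 0 ≤ c) (hnc : n * c ≤ 1 / 3) :
    (c + 1) ^ n ≤ 3 / 2 := by
  calc (c + 1) ^ n ≤ Real.exp c ^ n := by
        gcongr
        exact Real.add_one_le_exp c
    _ = Real.exp (n * c) := (Real.exp_nat_mul c n).symm
    _ ≤ Real.exp (1 / 3) := Real.exp_le_exp.2 hnc
    _ ≤ 1 / (1 - 1 / 3) := Real.exp_bound_div_one_sub_of_interval (by norm_num) (by norm_num)
    _ = 3 / 2 := by norm_num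

open Classical in
theorem sum_distanceHereditaryGraphs_pow_card_disagreement_le {δ : ℝ} (hδ : 0 ≤ δ)
    (hV : Fintype.card V * (4 * Fintype.card V ^ 2 * δ) ≤ 1 / 3) (H : SimpleGraph V) :
    ∑ G ∈ (distanceHereditaryGraphs V).erase H, δ ^ (disagreement G H).card ≤ 1 / 2 := by
  calc ∑ G ∈ (distanceHereditaryGraphs V).erase H, δ ^ (disagreement G H).card
      ≤ (4 * Fintype.card V ^ 2 * δ + 1) ^ Fintype.card V - 1 :=
        sum_pow_card_disagreement_le hδ
          (fun D => by exact_mod_cast card_image_induce_distanceHereditaryGraphs_le D) H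
    _ ≤ 3 / 2 - 1 := sub_le_sub_right (one_add_pow_le_three_halves (by positivity) hV) 1
    _ = 1 / 2 := by norm_num

end Disagreement

section AlmostOrthogonal

variable {𝕜 E ι : Type*} [RCLike 𝕜] [SeminormedAddCommGroup E] [InnerProductSpace 𝕜 E]

lemma norm_sum_smul_sq_le_of_sum_norm_inner_le {s : Finset ι} {ψ : ι → E} {K : ℝ}
    (h : ∀ i ∈ s, ∑ j ∈ s, ‖inner 𝕜 (ψ i) (ψ j)‖ ≤ K) (c : ι → 𝕜) :
    ‖∑ i ∈ s, c i • ψ i‖ ^ 2 ≤ K * ∑ i ∈ s, ‖c i‖ ^ 2 := by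
  have hswap : ∑ i ∈ s, ∑ j ∈ s, ‖c j‖ ^ 2 * ‖inner 𝕜 (ψ i) (ψ j)‖ =
      ∑ i ∈ s, ∑ j ∈ s, ‖c i‖ ^ 2 * ‖inner 𝕜 (ψ i) (ψ j)‖ := by
    rw [Finset.sum_comm]
    simp only [norm_inner_symm]
  calc ‖∑ i ∈ s, c i • ψ i‖ ^ 2
      = ‖∑ i ∈ s, ∑ j ∈ s, inner 𝕜 (c i • ψ i) (c j • ψ j)‖ := by
        simp_rw [← inner_sum, ← sum_inner, inner_self_eq_norm_sq_to_K, norm_pow, RCLike.norm_ofReal,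
          abs_norm]
    _ ≤ ∑ i ∈ s, ∑ j ∈ s, ‖inner 𝕜 (c i • ψ i) (c j • ψ j)‖ :=
        (norm_sum_le _ _).trans (Finset.sum_le_sum fun i _ => norm_sum_le _ _)
    _ ≤ ∑ i ∈ s, ∑ j ∈ s, (‖c i‖ ^ 2 * ‖inner 𝕜 (ψ i) (ψ j)‖ / 2 +
          ‖c j‖ ^ 2 * ‖inner 𝕜 (ψ i) (ψ j)‖ / 2) := by
        gcongr with i _ j _
        rw [inner_smul_left, inner_smul_right, norm_mul, norm_mul, RCLike.norm_conj, ← mul_assoc,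
          ← add_div, ← add_mul, mul_div_right_comm]
        gcongr
        linarith [two_mul_le_add_sq ‖c i‖ ‖c j‖]
    _ = ∑ i ∈ s, ‖c i‖ ^ 2 * ∑ j ∈ s, ‖inner 𝕜 (ψ i) (ψ j)‖ := by
        simp only [Finset.sum_add_distrib, ← Finset.sum_div, hswap, add_halves, Finset.mul_sum]
    _ ≤ ∑ i ∈ s, ‖c i‖ ^ 2 * K := by
        gcongr with i hi
        exact h i hi
    _ = K * ∑ i ∈ s, ‖c i‖ ^ 2 := by rw [← Finset.sum_mul, mul_comm]

/-- Bombieri's generalization of Bessel's inequality: the adjoint of the map bounded in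
`norm_sum_smul_sq_le_of_sum_norm_inner_le`. -/
theorem sum_norm_inner_sq_le_of_sum_norm_inner_le {s : Finset ι} {ψ : ι → E} {K : ℝ} (hK : 0 ≤ K)
    (h : ∀ i ∈ s, ∑ j ∈ s, ‖inner 𝕜 (ψ i) (ψ j)‖ ≤ K) (φ : E) :
    ∑ i ∈ s, ‖inner 𝕜 (ψ i) φ‖ ^ 2 ≤ K * ‖φ‖ ^ 2 := by
  set S : ℝ := ∑ i ∈ s, ‖inner 𝕜 (ψ i) φ‖ ^ 2 with hS
  set χ : E := ∑ i ∈ s, inner 𝕜 (ψ i) φ • ψ i with hχ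
  have hS_nonneg : 0 ≤ S := by positivity
  have hinner : inner 𝕜 χ φ = (S : 𝕜) := by
    simp only [hχ, hS, sum_inner, inner_smul_left, RCLike.conj_mul, map_sum, RCLike.ofReal_pow]
  have hχ_norm : ‖χ‖ ^ 2 ≤ K * S := norm_sum_smul_sq_le_of_sum_norm_inner_le h _
  have hS_le : S ≤ ‖χ‖ * ‖φ‖ := by
    simpa only [hinner, RCLike.norm_ofReal, abs_of_nonneg hS_nonneg]
      using norm_inner_le_norm (𝕜 := 𝕜) χ φ
  rcases hS_nonneg.eq_or_lt with hS_zero | hS_pos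
  · rw [← hS_zero]
    positivity
  refine le_of_mul_le_mul_left ?_ hS_pos
  calc S * S = S ^ 2 := (sq S).symm
    _ ≤ (‖χ‖ * ‖φ‖) ^ 2 := by gcongr
    _ = ‖χ‖ ^ 2 * ‖φ‖ ^ 2 := mul_pow _ _ _
    _ ≤ K * S * ‖φ‖ ^ 2 := by gcongr
    _ = S * (K * ‖φ‖ ^ 2) := by ring

end AlmostOrthogonal

section Discrimination

variable {B Γ : Type} [Fintype B]

lemma re_star_dotProduct_self (φ : B → ℂ) : (star φ ⬝ᵥ φ).re = ‖WithLp.toLp 2 φ‖ ^ 2 := by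
  rw [dotProduct_comm, ← EuclideanSpace.inner_toLp_toLp, inner_self_eq_norm_sq_to_K]
  norm_cast

lemma norm_star_dotProduct_comm (ψ φ : B → ℂ) : ‖star ψ ⬝ᵥ φ‖ = ‖star φ ⬝ᵥ ψ‖ := by
  rw [Matrix.star_dotProduct, norm_star]

lemma norm_star_dotProduct_le_one {ψ φ : B → ℂ} (hψ : star ψ ⬝ᵥ ψ = 1) (hφ : star φ ⬝ᵥ φ = 1) :
    ‖star ψ ⬝ᵥ φ‖ ≤ 1 := by
  have norm_eq_one : ∀ χ : B → ℂ, star χ ⬝ᵥ χ = 1 → ‖WithLp.toLp 2 χ‖ = 1 := fun χ hχ => by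
    rw [← pow_eq_one_iff_of_nonneg (norm_nonneg _) two_ne_zero, ← re_star_dotProduct_self,
      hχ, Complex.one_re]
  simpa only [EuclideanSpace.inner_toLp_toLp, dotProduct_comm φ, norm_eq_one ψ hψ,
    norm_eq_one φ hφ, mul_one]
    using norm_inner_le_norm (𝕜 := ℂ) (WithLp.toLp 2 ψ) (WithLp.toLp 2 φ)

lemma re_star_dotProduct_smul_vecMulVec_mulVec (c : ℝ) (ψ φ : B → ℂ) :
    (star φ ⬝ᵥ (c • Matrix.vecMulVec ψ (star ψ)) *ᵥ φ).re = c * ‖star ψ ⬝ᵥ φ‖ ^ 2 := by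
  rw [Matrix.smul_mulVec, dotProduct_smul, Matrix.vecMulVec_mulVec, dotProduct_smul,
    op_smul_eq_mul, Matrix.star_dotProduct φ ψ, Complex.star_def, Complex.conj_mul',
    ← Complex.ofReal_pow, Complex.smul_re, Complex.ofReal_re, smul_eq_mul]

open Classical in
lemma sum_norm_star_dotProduct_sq_le {s : Finset Γ} {ψ : Γ → B → ℂ} {ε : ℝ} (hε : 0 ≤ ε)
    (hunit : ∀ i ∈ s, star (ψ i) ⬝ᵥ ψ i = 1)
    (hoverlap : ∀ i ∈ s, ∑ j ∈ s.erase i, ‖star (ψ j) ⬝ᵥ ψ i‖ ≤ ε) (φ : B → ℂ) :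
    ∑ i ∈ s, ‖star (ψ i) ⬝ᵥ φ‖ ^ 2 ≤ (1 + ε) * (star φ ⬝ᵥ φ).re := by
  have hrow : ∀ i ∈ s, ∑ j ∈ s, ‖star (ψ i) ⬝ᵥ ψ j‖ ≤ 1 + ε := fun i hi => by
    simp only [norm_star_dotProduct_comm (ψ i)]
    rw [← Finset.add_sum_erase s _ hi, hunit i hi, norm_one]
    gcongr
    exact hoverlap i hi
  have := sum_norm_inner_sq_le_of_sum_norm_inner_le (𝕜 := ℂ) (s := s) (K := 1 + ε)
    (ψ := fun i => WithLp.toLp 2 (ψ i)) (by positivity)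
    (by simpa only [EuclideanSpace.inner_toLp_toLp, dotProduct_comm _ (star _)] using hrow)
    (WithLp.toLp 2 φ)
  simpa only [EuclideanSpace.inner_toLp_toLp, dotProduct_comm _ (star _), re_star_dotProduct_self]
    using this

variable [DecidableEq B]

lemma re_star_dotProduct_one_sub_sum_mulVec (s : Finset Γ) (ψ : Γ → B → ℂ) (c : ℝ) (φ : B → ℂ) :
    (star φ ⬝ᵥ (1 - ∑ i ∈ s, c • Matrix.vecMulVec (ψ i) (star (ψ i))) *ᵥ φ).re =
      (star φ ⬝ᵥ φ).re - c * ∑ i ∈ s, ‖star (ψ i) ⬝ᵥ φ‖ ^ 2 := by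
  simp only [Matrix.sub_mulVec, Matrix.one_mulVec, dotProduct_sub, Matrix.sum_mulVec,
    dotProduct_sum, Complex.sub_re, Complex.re_sum, re_star_dotProduct_smul_vecMulVec_mulVec,
    Finset.mul_sum]

variable [Fintype Γ]

open Classical in
/-- The measurement with the effects `c |ψ i⟩⟨ψ i|` for `i ∈ s`, and with the outcome `none` for
the remainder; its purpose is to identify which of the states `ψ i` is measured. -/
noncomputable def Measurement.ofStates (s : Finset Γ) (ψ : Γ → B → ℂ) (c : ℝ) (hc : 0 ≤ c)
    (hψ : ∀ φ : B → ℂ, c * ∑ i ∈ s, ‖star (ψ i) ⬝ᵥ φ‖ ^ 2 ≤ (star φ ⬝ᵥ φ).re) :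
    Measurement B (Option Γ) where
  effect o := o.elim (1 - ∑ i ∈ s, c • Matrix.vecMulVec (ψ i) (star (ψ i))) fun i =>
    if i ∈ s then c • Matrix.vecMulVec (ψ i) (star (ψ i)) else 0
  posSemidef := by
    have hpos : ∀ i, (c • Matrix.vecMulVec (ψ i) (star (ψ i))).PosSemidef := fun i =>
      (Matrix.posSemidef_vecMulVec_self_star (ψ i)).smul hc
    rintro (_ | i)
    · have hherm : (1 - ∑ i ∈ s, c • Matrix.vecMulVec (ψ i) (star (ψ i))).IsHermitian :=
        Matrix.isHermitian_one.sub (Matrix.posSemidef_sum s fun i _ => hpos i).isHermitian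
      refine .of_dotProduct_mulVec_nonneg hherm fun φ => Complex.nonneg_iff.2 ⟨?_, ?_⟩
      · exact (sub_nonneg.2 (hψ φ)).trans_eq (re_star_dotProduct_one_sub_sum_mulVec s ψ c φ).symm
      · exact (hherm.im_star_dotProduct_mulVec_self φ).symm
    · dsimp only [Option.elim]
      split_ifs
      exacts [hpos i, .zero]
  sum_effect := by
    simp only [Fintype.sum_option, Option.elim, Finset.sum_ite_mem, Finset.univ_inter,
      sub_add_cancel]

namespace Measurement

variable {s : Finset Γ} {ψ : Γ → B → ℂ} {c : ℝ} {hc : 0 ≤ c}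
  {hψ : ∀ φ : B → ℂ, c * ∑ i ∈ s, ‖star (ψ i) ⬝ᵥ φ‖ ^ 2 ≤ (star φ ⬝ᵥ φ).re}

lemma prob_ofStates_some {i : Γ} (hi : i ∈ s) (φ : B → ℂ) :
    (ofStates s ψ c hc hψ).prob φ (some i) = c * ‖star (ψ i) ⬝ᵥ φ‖ ^ 2 := by
  simp only [prob, ofStates, Option.elim, if_pos hi, re_star_dotProduct_smul_vecMulVec_mulVec]

lemma prob_ofStates_none (φ : B → ℂ) :
    (ofStates s ψ c hc hψ).prob φ none =
      (star φ ⬝ᵥ φ).re - c * ∑ i ∈ s, ‖star (ψ i) ⬝ᵥ φ‖ ^ 2 :=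
  re_star_dotProduct_one_sub_sum_mulVec s ψ c φ

end Measurement

open Classical in
theorem exists_measurement_of_sum_overlap_le {s : Finset Γ} {ψ : Γ → B → ℂ} {ε : ℝ} (hε : 0 ≤ ε)
    (hunit : ∀ i, star (ψ i) ⬝ᵥ ψ i = 1)
    (hoverlap : ∀ i, ∑ j ∈ s.erase i, ‖star (ψ j) ⬝ᵥ ψ i‖ ≤ ε) :
    ∃ M : Measurement B (Option Γ),
      ∀ i, (1 + ε)⁻¹ ≤ M.prob (ψ i) (if i ∈ s then some i else none) := by
  have hε' : 0 < 1 + ε := by positivity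
  refine ⟨.ofStates s ψ (1 + ε)⁻¹ (by positivity) fun φ => ?_, fun i => ?_⟩
  · rw [inv_mul_le_iff₀ hε']
    exact sum_norm_star_dotProduct_sq_le hε (fun i _ => hunit i) (fun i _ => hoverlap i) φ
  split_ifs with hi
  · rw [Measurement.prob_ofStates_some hi, hunit, norm_one, one_pow, mul_one]
  · rw [Measurement.prob_ofStates_none, hunit, Complex.one_re]
    have hsq : ∑ j ∈ s, ‖star (ψ j) ⬝ᵥ ψ i‖ ^ 2 ≤ ε := by
      refine le_trans (Finset.sum_le_sum fun j _ => ?_)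
        (Finset.erase_eq_of_notMem hi ▸ hoverlap i)
      exact pow_le_of_le_one (norm_nonneg _) (norm_star_dotProduct_le_one (hunit j) (hunit i))
        two_ne_zero
    calc (1 + ε)⁻¹ = 1 - (1 + ε)⁻¹ * ε := by field_simp; ring
      _ ≤ 1 - (1 + ε)⁻¹ * ∑ j ∈ s, ‖star (ψ j) ⬝ᵥ ψ i‖ ^ 2 := by gcongr

end Discrimination

section ProductStates

lemma star_prod_dotProduct_prod {ι : Type*} [Fintype ι] [DecidableEq ι] {B : ι → Type*}
    [∀ v, Fintype (B v)] (ψ φ : ∀ v, B v → ℂ) :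
    star (fun b : ∀ v, B v => ∏ v, ψ v (b v)) ⬝ᵥ (fun b => ∏ v, φ v (b v)) =
      ∏ v, star (ψ v) ⬝ᵥ φ v := by
  simp only [dotProduct, Pi.star_apply, star_prod, ← Finset.prod_mul_distrib,
    Fintype.prod_sum]

lemma PureState.star_dotProduct_self {B : Type} [Fintype B] (ψ : PureState B) :
    star ψ.amp ⬝ᵥ ψ.amp = 1 := by
  simp only [dotProduct, Pi.star_apply, Complex.star_def, Complex.conj_mul']
  exact_mod_cast ψ.norm_one

end ProductStates

section Fingerprint

variable {A B C : Type} [Fintype A] [Fintype B] [DecidableEq C]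

lemma card_filter_graph_inter_graph (e : B ≃ A × C) (f g : A → C) :
    ({b | f (e b).1 = (e b).2 ∧ g (e b).1 = (e b).2} : Finset B).card =
      ({a | f a = g a} : Finset A).card := by
  refine Finset.card_nbij' (fun b => (e b).1) (fun a => e.symm (a, f a)) ?_ ?_ ?_ ?_
  · intro b hb
    simp only [Finset.coe_filter, Finset.mem_univ, true_and, Set.mem_ofPred_eq] at hb ⊢
    rw [hb.1, hb.2]
  · intro a ha
    simpa [eq_comm] using ha
  · intro b hb
    simp only [Finset.coe_filter, Finset.mem_univ, true_and, Set.mem_ofPred_eq] at hb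
    simp only [hb.1, Prod.mk.eta, Equiv.symm_apply_apply]
  · intro a _
    simp only [Equiv.apply_symm_apply]

/-- The fingerprint of a function `f : A → C` on a register whose basis is indexed by `A × C`: the
uniform superposition of the graph of `f`. -/
noncomputable def fingerprint [Nonempty A] (e : B ≃ A × C) (f : A → C) : PureState B where
  amp b := if f (e b).1 = (e b).2 then ((√(Fintype.card A))⁻¹ : ℝ) else 0
  norm_one := by
    have hcard := card_filter_graph_inter_graph e f f
    simp only [and_self, Finset.filter_true, Finset.card_univ] at hcard
    simp only [apply_ite, norm_zero, ite_pow, Complex.norm_real, Real.norm_eq_abs, sq_abs,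
      inv_pow, Real.sq_sqrt (Nat.cast_nonneg _), zero_pow two_ne_zero, ← Finset.sum_filter,
      Finset.sum_const, hcard, nsmul_eq_mul]
    exact mul_inv_cancel₀ (Nat.cast_ne_zero.2 Fintype.card_ne_zero)

lemma star_fingerprint_dotProduct_fingerprint [Nonempty A] (e : B ≃ A × C) (f g : A → C) :
    star (fingerprint e f).amp ⬝ᵥ (fingerprint e g).amp =
      (({a | f a = g a} : Finset A).card / Fintype.card A : ℂ) := by
  have hsq : (((√(Fintype.card A))⁻¹ : ℝ) : ℂ) * ((√(Fintype.card A))⁻¹ : ℝ) =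
      (Fintype.card A : ℂ)⁻¹ := by
    rw [← Complex.ofReal_mul, ← mul_inv, Real.mul_self_sqrt (Nat.cast_nonneg _)]
    push_cast
    rfl
  simp only [dotProduct, Pi.star_apply, fingerprint, apply_ite star, star_zero, Complex.star_def,
    Complex.conj_ofReal, ite_zero_mul_ite_zero, hsq, ← Finset.sum_filter, Finset.sum_const,
    card_filter_graph_inter_graph, nsmul_eq_mul, div_eq_mul_inv]

open Polynomial in
lemma card_filter_aeval_ofFn_eq_lt {K F : Type*} [CommRing K] [CommRing F] [IsDomain F] [Fintype F]
    [DecidableEq F] [DecidableEq K] [Algebra K F] [FaithfulSMul K F] {k : ℕ} {x y : Fin k → K}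
    (hxy : x ≠ y) :
    ({a | aeval a (ofFn k x) = aeval a (ofFn k y)} : Finset F).card < k := by
  by_contra! hk
  have hdeg : ∀ z : Fin k → K, ((ofFn k z).map (algebraMap K F)).degree <
      ({a | aeval a (ofFn k x) = aeval a (ofFn k y)} : Finset F).card := fun z =>
    (degree_map_le.trans_lt (ofFn_degree_lt z)).trans_le (by exact_mod_cast hk)
  refine hxy (injective_ofFn k (map_injective _ (FaithfulSMul.algebraMap_injective K F) ?_))
  refine eq_of_degrees_lt_of_eval_finset_eq _ (hdeg x) (hdeg y) fun a ha => ?_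
  simpa only [eval_map_algebraMap] using (Finset.mem_filter.1 ha).2

theorem exists_fingerprint_overlap_le (k : ℕ) {n : ℕ} (hn : n ≠ 0) :
    ∃ m : (Fin k → ZMod 2) → PureState (QubitBasis (2 * n)),
      ∀ x y, x ≠ y → ‖star (m x).amp ⬝ᵥ (m y).amp‖ ≤ k / 2 ^ n := by
  classical
  let F := GaloisField 2 n
  have : Fintype F := Fintype.ofFinite F
  have hF : Fintype.card F = 2 ^ n := by
    rw [← Nat.card_eq_fintype_card, GaloisField.card 2 n hn]
  have e : QubitBasis (2 * n) ≃ F × F := Fintype.equivOfCardEq <| by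
    simp only [QubitBasis, Fintype.card_fun, Fintype.card_bool, Fintype.card_fin,
      Fintype.card_prod, hF, two_mul, pow_add]
  refine ⟨fun x => fingerprint e fun a => Polynomial.aeval a (Polynomial.ofFn k x),
    fun x y hxy => ?_⟩
  rw [star_fingerprint_dotProduct_fingerprint, norm_div, Complex.norm_natCast,
    Complex.norm_natCast, hF, Nat.cast_pow, Nat.cast_ofNat]
  gcongr
  exact (card_filter_aeval_ofFn_eq_lt hxy).le

end Fingerprint

section Protocol

variable {k q : ℕ} {G H : SimpleGraph (Fin k)} {m : (Fin k → ZMod 2) → PureState (QubitBasis q)}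

lemma neighborhoodVector_eq_iff {v : Fin k} :
    neighborhoodVector G v = neighborhoodVector H v ↔ G.neighborSet v = H.neighborSet v := by
  simp only [funext_iff, Set.ext_iff, SimpleGraph.mem_neighborSet, neighborhoodVector]
  refine forall_congr' fun u => ?_
  by_cases hG : G.Adj v u <;> by_cases hH : H.Adj v u <;> simp [hG, hH]

/-- The joint state that the referee receives on the graph `G` when every player encodes its
neighborhood vector by `m`. -/
noncomputable def graphState (m : (Fin k → ZMod 2) → PureState (QubitBasis q))
    (G : SimpleGraph (Fin k)) : (Fin k → QubitBasis q) → ℂ :=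
  fun b => ∏ v, (m (neighborhoodVector G v)).amp (b v)

lemma star_graphState_dotProduct_graphState (G H : SimpleGraph (Fin k)) :
    star (graphState m G) ⬝ᵥ graphState m H =
      ∏ v, star (m (neighborhoodVector G v)).amp ⬝ᵥ (m (neighborhoodVector H v)).amp :=
  star_prod_dotProduct_prod _ _

lemma star_graphState_dotProduct_self (G : SimpleGraph (Fin k)) :
    star (graphState m G) ⬝ᵥ graphState m G = 1 := by
  simp only [star_graphState_dotProduct_graphState, PureState.star_dotProduct_self,
    Finset.prod_const_one]

lemma norm_star_graphState_dotProduct_graphState_le {δ : ℝ}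
    (hm : ∀ x y, x ≠ y → ‖star (m x).amp ⬝ᵥ (m y).amp‖ ≤ δ) (G H : SimpleGraph (Fin k)) :
    ‖star (graphState m G) ⬝ᵥ graphState m H‖ ≤ δ ^ (disagreement G H).card := by
  classical
  rw [star_graphState_dotProduct_graphState, norm_prod, ← Finset.prod_const,
    ← Fintype.prod_ite_mem (disagreement G H)]
  refine Finset.prod_le_prod (fun _ _ => norm_nonneg _) fun v _ => ?_
  split_ifs with hv
  · exact hm _ _ fun h => notMem_disagreement.2 (neighborhoodVector_eq_iff.1 h) hv
  · rw [neighborhoodVector_eq_iff.2 (notMem_disagreement.1 hv), PureState.star_dotProduct_self,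
      norm_one]

open Classical in
theorem exists_solvesNIH_reconstructDistanceHereditary_of_overlap_le {δ : ℝ}
    (hm : ∀ x y, x ≠ y → ‖star (m x).amp ⬝ᵥ (m y).amp‖ ≤ δ)
    (hδ : ∀ H, ∑ G ∈ (distanceHereditaryGraphs (Fin k)).erase H,
      δ ^ (disagreement G H).card ≤ 1 / 2) :
    ∃ P : QuantumSMP k (Fin k → ZMod 2) (Option (SimpleGraph (Fin k))),
      P.cost = k * q ∧ P.SolvesNIH reconstructDistanceHereditary := by
  have hoverlap : ∀ H, ∑ G ∈ (distanceHereditaryGraphs (Fin k)).erase H,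
      ‖star (graphState m G) ⬝ᵥ graphState m H‖ ≤ 1 / 2 := fun H =>
    (Finset.sum_le_sum fun G _ => norm_star_graphState_dotProduct_graphState_le hm G H).trans (hδ H)
  obtain ⟨M, hM⟩ := exists_measurement_of_sum_overlap_le one_half_pos.le
    star_graphState_dotProduct_self hoverlap
  refine ⟨⟨fun _ => q, fun _ => m, M⟩, by simp [QuantumSMP.cost], fun G => ?_⟩
  calc (2 / 3 : ℝ) = (1 + 1 / 2)⁻¹ := by norm_num
    _ ≤ M.prob (graphState m G) (reconstructDistanceHereditary G) := by
      simpa only [mem_distanceHereditaryGraphs, reconstructDistanceHereditary] using hM G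

theorem exists_solvesNIH_reconstructDistanceHereditary (k : ℕ) :
    ∃ P : QuantumSMP k (Fin k → ZMod 2) (Option (SimpleGraph (Fin k))),
      P.cost = k * (2 * (4 * Nat.clog 2 k + 4)) ∧ P.SolvesNIH reconstructDistanceHereditary := by
  set n := 4 * Nat.clog 2 k + 4 with hn
  have hoverlap : k * (4 * k ^ 2 * (k / 2 ^ n)) ≤ (1 / 3 : ℝ) := by
    have hk : (k : ℝ) ≤ 2 ^ Nat.clog 2 k := by exact_mod_cast Nat.le_pow_clog one_lt_two k
    calc k * (4 * k ^ 2 * (k / 2 ^ n)) = 4 * (k : ℝ) ^ 4 / 2 ^ n := by ring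
      _ ≤ 4 * (2 ^ Nat.clog 2 k) ^ 4 / 2 ^ n := by gcongr
      _ = 1 / 4 := by
        have : (2 : ℝ) ^ n = 16 * (2 ^ Nat.clog 2 k) ^ 4 := by rw [hn]; ring
        rw [this]
        field_simp
        norm_num
      _ ≤ 1 / 3 := by norm_num
  obtain ⟨m, hm⟩ := exists_fingerprint_overlap_le k (n := n) (by lia)
  exact exists_solvesNIH_reconstructDistanceHereditary_of_overlap_le hm
    (sum_distanceHereditaryGraphs_pow_card_disagreement_le (by positivity)
      (by rwa [Fintype.card_fin]))

lemma exists_solvesNIH_reconstructDistanceHereditary_of_le_one {k : ℕ} (hk : k ≤ 1) :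
    ∃ P : QuantumSMP k (Fin k → ZMod 2) (Option (SimpleGraph (Fin k))),
      P.cost = 0 ∧ P.SolvesNIH reconstructDistanceHereditary := by
  have : Subsingleton (Fin k) := Fin.subsingleton_iff_le_one.2 hk
  refine exists_solvesNIH_reconstructDistanceHereditary_of_overlap_le (q := 0) (δ := 1)
    (m := fun _ => ⟨fun _ => 1, by simp⟩) (by simp [dotProduct]) fun H => ?_
  refine le_of_eq_of_le (Finset.sum_eq_zero fun G hG => ?_) one_half_pos.le
  simp only [Subsingleton.elim G H, Finset.notMem_erase] at hG

end Protocol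

lemma one_le_logb_two {k : ℕ} (hk : 2 ≤ k) : 1 ≤ Real.logb 2 k := by
  rw [Real.le_logb_iff_rpow_le one_lt_two (by positivity), Real.rpow_one]
  exact_mod_cast hk

theorem mainTheorem3_general (k : ℕ) :
    ∃ P : QuantumSMP k (Fin k → ZMod 2) (Option (SimpleGraph (Fin k))),
      (P.cost : ℝ) ≤ 24 * (k * Real.logb 2 k) ∧ P.SolvesNIH reconstructDistanceHereditary := by
  rcases le_or_gt k 1 with hk | hk
  · obtain ⟨P, hcost, hP⟩ := exists_solvesNIH_reconstructDistanceHereditary_of_le_one hk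
    refine ⟨P, ?_, hP⟩
    interval_cases k <;> simp [hcost]
  obtain ⟨P, hcost, hP⟩ := exists_solvesNIH_reconstructDistanceHereditary k
  have hlog : 1 ≤ Real.logb 2 k := one_le_logb_two hk
  have hclog : (Nat.clog 2 k : ℝ) ≤ Real.logb 2 k + 1 := by
    rw [← Real.natCeil_logb_natCast 2 k]
    exact_mod_cast (Nat.ceil_lt_add_one (zero_le_one.trans hlog)).le
  refine ⟨P, ?_, hP⟩
  calc (P.cost : ℝ) = k * (8 * (Nat.clog 2 k + 1)) := by rw [hcost]; push_cast; ring
    _ ≤ k * (24 * Real.logb 2 k) := mul_le_mul_of_nonneg_left (by linarith) (Nat.cast_nonneg k)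
    _ = 24 * (k * Real.logb 2 k) := by ring

theorem mainTheorem3 :
    ∃ C : ℝ, ∀ k : ℕ,
      ∃ P : QuantumSMP k (Fin k → ZMod 2) (Option (SimpleGraph (Fin k))),
        (P.cost : ℝ) ≤ C * (k * Real.log k ^ 2) ∧
        P.SolvesNIH reconstructDistanceHereditary := by
  refine ⟨24 / Real.log 2 ^ 2, fun k => (mainTheorem3_general k).imp fun P hP => ⟨?_, hP.2⟩⟩
  have hlog : Real.logb 2 k ≤ Real.logb 2 k ^ 2 := by
    rcases le_or_gt k 1 with hk | hk
    · interval_cases k <;> simp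
    · exact le_self_pow₀ (one_le_logb_two hk) two_ne_zero
  calc (P.cost : ℝ) ≤ 24 * (k * Real.logb 2 k) := hP.1
    _ ≤ 24 * (k * Real.logb 2 k ^ 2) := by gcongr
    _ = 24 / Real.log 2 ^ 2 * (k * Real.log k ^ 2) := by rw [Real.logb]; ring
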